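/- Let $X$ be a complex Banach space with open unit ball $B$, and let $\bar B^{**}$ be the closed unit ball of the bidual $X^{**}$. Let $H^\infty(B)$ be the algebra of bounded holomorphic functions on $B$ with the supremum norm, and $A_u(B)\subseteq H^\infty(B)$ the subalgebra of uniformly continuous functions. Let $H(B)$ be a uniform algebra with $A_u(B)\subseteq H(B)\subseteq H^\infty(B)$, that is, a closed unital subalgebra of $H^\infty(B)$ containing $A_u(B)$; let $M_{H(B)}$ be its spectrum (the nonzero multiplicative linear functionals) and $\hat f$ the Gelfand transform of $f\in H(B)$. For a continuous polynomial $P$ on $X$, let $\tilde P$ be its Aron–Berner extension to $X^{**}$. The polynomial-star topology $w(X^{**},P(X))$ is the smallest topology on $X^{**}$ for which $\tilde P$ is continuous for every continuous polynomial $P$ on $X$. For $g\in A_u(B)$ with Taylor series $g=\sum_n P_n$ at $0$, let $\tilde g$ be the continuous extension to $\bar B^{**}$ of the function $z\mapsto\sum_n\tilde P_n(z)$ on the open unit ball of $X^{**}$. The polynomial fiber over $z\in\bar B^{**}$ is $$M^{\mathcal P}_{z}=\{\tau\in M_{H(B)} : \tau(g)=\tilde g(z)\ \text{ for all } g\in A_u(B)\}.$$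 Let $x_0^{**}\in\bar B^{**}$ and $f\in H(B)$, and suppose that $\hat f$ is constant, equal to $\lambda$, on $M^{\mathcal P}_{x_0^{**}}$. Then $f$ extends to $x_0^{**}$ with $w(X^{**},P(X))$-continuity: regarding $B$ as a subset of $X^{**}$, there is an extension of $f$ to $B\cup\{x_0^{**}\}$ which takes the value $\lambda$ at $x_0^{**}$ and is continuous at $x_0^{**}$ for the topology induced by $w(X^{**},P(X))$. That is, $f(x_\alpha)\to\lambda$ for every net $(x_\alpha)$ in $B$ that converges to $x_0^{**}$ in $w(X^{**},P(X))$. -/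

import Mathlib

open Set Filter Topology Metric
open scoped BoundedContinuousFunction Nat

noncomputable section

namespace PolyCluster

variable (X : Type*) [NormedAddCommGroup X] [NormedSpace ℂ X]

/-- The bidual `X**`, with its usual norm. -/
abbrev Bidual : Type _ := StrongDual ℂ (StrongDual ℂ X)

/-- The open unit ball `B` of `X`, as a type. -/
abbrev UnitBall : Type _ := ball (0 : X) 1

variable {X}

/-- The canonical embedding of `B` into the bidual. -/
def UnitBall.toBidual (x : UnitBall X) : Bidual X :=
  NormedSpace.inclusionInDoubleDual ℂ X (x : X)

/-! ### Arens extension and Aron-Berner extension of polynomials -/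

/-- Evaluation of the Arens extension at `(z 0, …, z (n-1))`: the map `A ↦ Ã(z 0, …, z (n-1))`,
defined on continuous `n`-linear forms `A` on `X`.
The variables are extended by weak-star continuity one at a time:
`Ã(z 0, z 1, …) = z 0 (x ↦ (A(x, ·))~(z 1, …))`. -/
def arensEval : (n : ℕ) → (Fin n → Bidual X) → ((X [×n]→L[ℂ] ℂ) →L[ℂ] ℂ)
  | 0, _ => (continuousMultilinearCurryFin0 ℂ X ℂ).toContinuousLinearEquiv.toContinuousLinearMap
  | n + 1, z =>
    (z 0).comp
      ((ContinuousLinearMap.compL ℂ X (X [×n]→L[ℂ] ℂ) ℂ (arensEval n (Fin.tail z))).comp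
        (continuousMultilinearCurryLeftEquiv ℂ
          (fun _ : Fin (n + 1) => X) ℂ).toContinuousLinearEquiv.toContinuousLinearMap)

/-- For a symmetric continuous `n`-linear form `A` with polynomial `P x = A(x, …, x)`, the value
`P̃ z = Ã(z, …, z)` of the Aron-Berner extension of `P`. -/
def aronBernerHom (n : ℕ) (A : X [×n]→L[ℂ] ℂ) (z : Bidual X) : ℂ :=
  arensEval n (fun _ => z) A

variable (X) in
/-- A continuous polynomial on `X`, given by the symmetric continuous multilinear forms of its
homogeneous components: `P x = ∑_{n ≤ deg} form n (x, …, x)`. -/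
structure ContPoly where
  /-- a bound for the degree -/
  deg : ℕ
  /-- the symmetric `n`-linear form of the `n`-homogeneous component -/
  form : (n : ℕ) → X [×n]→L[ℂ] ℂ
  symm : ∀ (n : ℕ) (σ : Equiv.Perm (Fin n)) (v : Fin n → X), form n (v ∘ σ) = form n v

/-- The polynomial as a function on `X`. -/
def ContPoly.eval (P : ContPoly X) (x : X) : ℂ :=
  ∑ n ∈ Finset.range (P.deg + 1), P.form n (fun _ => x)

/-- The Aron-Berner extension of a continuous polynomial to the bidual. -/
def ContPoly.aronBerner (P : ContPoly X) (z : Bidual X) : ℂ :=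
  ∑ n ∈ Finset.range (P.deg + 1), aronBernerHom n (P.form n) z

variable (X) in
/-- The polynomial-star topology `w(X**, P(X))`: the smallest topology on the bidual that makes the
Aron-Berner extension of every continuous polynomial continuous. -/
@[reducible] def polyStarTopology : TopologicalSpace (Bidual X) :=
  ⨅ P : ContPoly X, TopologicalSpace.induced P.aronBerner inferInstance

/-! ### The function algebras on the ball -/

/-- A function on `B`, extended by zero to `X` (only its values on `B` matter). -/
def zeroExt (g : UnitBall X →ᵇ ℂ) : X → ℂ :=
  Function.extend Subtype.val g 0

variable (X) in
/-- `H^∞(B)`: the bounded holomorphic functions on `B`, where a function is holomorphic if it is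
given by a convergent power series of continuous polynomials near each point of `B`. -/
def HInfty : Set (UnitBall X →ᵇ ℂ) :=
  {g | AnalyticOnNhd ℂ (zeroExt g) (ball (0 : X) 1)}

variable (X) in
/-- `A_u(B)`: the (bounded) holomorphic functions on `B` that are uniformly continuous. -/
def Au : Set (UnitBall X →ᵇ ℂ) :=
  {g | g ∈ HInfty X ∧ UniformContinuous g}

/-! ### Aron-Berner extension of holomorphic functions, and the polynomial fibers -/

/-- The symmetric `n`-linear form `Dⁿg(0) / n!` of the `n`-th Taylor polynomial of `g` at `0`. -/
def taylorForm (g : UnitBall X →ᵇ ℂ) (n : ℕ) : X [×n]→L[ℂ] ℂ :=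
  ((n ! : ℂ)⁻¹) • iteratedFDeriv ℂ n (zeroExt g) 0

/-- The Aron-Berner extension `g̃ z = ∑ P̃ₙ z` of `g = ∑ Pₙ` to the open unit ball of the bidual. -/
def aronBernerBall (g : UnitBall X →ᵇ ℂ) (z : Bidual X) : ℂ :=
  ∑' n : ℕ, aronBernerHom n (taylorForm g n) z

/-- The Aron-Berner extension of `g ∈ A_u(B)`, continuously extended from the open unit ball of the
bidual to the closed one. Thus `g ↦ aronBernerClosedBall g z` is the character `δ_z` of `A_u(B)`. -/
def aronBernerClosedBall (g : UnitBall X →ᵇ ℂ) : Bidual X → ℂ :=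
  extendFrom (ball (0 : Bidual X) 1) (aronBernerBall g)

/-- The polynomial fiber over `z` of the spectrum of `H`: the characters of `H` whose restriction
to `A_u(B)` is `δ_z`. -/
def polyFiber (H : Subalgebra ℂ (UnitBall X →ᵇ ℂ)) (z : Bidual X) :
    Set (WeakDual.characterSpace ℂ H) :=
  {τ | ∀ g : H, (g : UnitBall X →ᵇ ℂ) ∈ Au X → τ g = aronBernerClosedBall (g : UnitBall X →ᵇ ℂ) z}

end PolyCluster

end

/-!
Suppose `f x` does not tend to `c` as `x ∈ B` tends to `z₀` in the polynomial-star topology. Then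
some ultrafilter `u` on `B` converges to `z₀` while `f` does not tend to `c` along `u`. The limit
along `u` is a character `τ` of `H` with `τ f ≠ c`, so it remains to see that `τ` lies in the fiber
over `z₀`, that is, `τ g = g̃ z₀` for `g ∈ A_u(B)` (`aronBernerClosedBall_eq_of_tendsto`).

For a polynomial `P`, the definition of the topology gives `lim P x = P̃ z₀`. A function
`g ∈ A_u(B)` is a uniform limit on `B` of polynomials, namely of Taylor polynomials of dilations
`x ↦ g (r x)`. The extensions of these polynomials converge to `g̃` uniformly on the open unit ball
of the bidual (`exists_contPoly_close`); since they are norm continuous, `g̃` extends continuously to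
`z₀`, with value `lim g x`.

That uniform convergence, and even the convergence of the series defining `g̃` on the whole open
ball, rests on the theorem of Davie and Gamelin that the Aron-Berner extension does not increase
the sup norm of a polynomial on a ball (`ContPoly.norm_aronBerner_le`). To prove it, walk from `z` to
a point of `X` along points `y + s z` with `y ∈ X`, replacing in each of `N` steps the increment
`z / N` by `x / N` with `x` in the ball. To first order the change of `P̃` is given by the derivative
at `y + s z`, and on `X + ℂ z` this derivative is evaluation at one functional `ℓ ∈ X*`: variables
from `X + ℂ z` commute in the Arens extension of a symmetric form
(`IsSymmForm.arensDeriv_succ`). As `‖z‖` is less than the radius, `x` can be chosen with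
`ℓ x = z ℓ`. The error is then `O(1 / N²)` per step, and `O(1 / N)` in total.
-/

noncomputable section

namespace PolyCluster

variable {X : Type*} [NormedAddCommGroup X] [NormedSpace ℂ X]

/-! ### Arens extension one variable at a time -/

/-- One step of the Arens extension: from a functional `Φ` on `n`-linear forms, the functional
`A ↦ u (x ↦ Φ (A (x, ·)))` on `(n + 1)`-linear forms. -/
def arensStep {n : ℕ} (u : Bidual X) (Φ : (X [×n]→L[ℂ] ℂ) →L[ℂ] ℂ) :
    (X [×(n + 1)]→L[ℂ] ℂ) →L[ℂ] ℂ :=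
  u.comp ((ContinuousLinearMap.compL ℂ X (X [×n]→L[ℂ] ℂ) ℂ Φ).comp
    (continuousMultilinearCurryLeftEquiv ℂ
      (fun _ : Fin (n + 1) => X) ℂ).toContinuousLinearEquiv.toContinuousLinearMap)

lemma arensStep_apply {n : ℕ} (u : Bidual X) (Φ : (X [×n]→L[ℂ] ℂ) →L[ℂ] ℂ)
    (A : X [×(n + 1)]→L[ℂ] ℂ) : arensStep u Φ A = u (Φ.comp A.curryLeft) := rfl

lemma arensStep_add_left {n : ℕ} (u v : Bidual X) (Φ : (X [×n]→L[ℂ] ℂ) →L[ℂ] ℂ) :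
    arensStep (u + v) Φ = arensStep u Φ + arensStep v Φ := rfl

lemma arensStep_smul_left {n : ℕ} (s : ℂ) (u : Bidual X) (Φ : (X [×n]→L[ℂ] ℂ) →L[ℂ] ℂ) :
    arensStep (s • u) Φ = s • arensStep u Φ := rfl

lemma arensStep_add_right {n : ℕ} (u : Bidual X) (Φ Ψ : (X [×n]→L[ℂ] ℂ) →L[ℂ] ℂ) :
    arensStep u (Φ + Ψ) = arensStep u Φ + arensStep u Ψ := by
  ext A; simp [arensStep_apply, ContinuousLinearMap.add_comp]

lemma arensStep_smul_right {n : ℕ} (s : ℂ) (u : Bidual X) (Φ : (X [×n]→L[ℂ] ℂ) →L[ℂ] ℂ) :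
    arensStep u (s • Φ) = s • arensStep u Φ := by
  ext A; simp [arensStep_apply, ContinuousLinearMap.smul_comp]

lemma norm_arensStep_le {n : ℕ} (u : Bidual X) (Φ : (X [×n]→L[ℂ] ℂ) →L[ℂ] ℂ) :
    ‖arensStep u Φ‖ ≤ ‖u‖ * ‖Φ‖ := by
  refine ContinuousLinearMap.opNorm_le_bound _ (by positivity) fun A => ?_
  rw [arensStep_apply, mul_assoc]
  refine (u.le_opNorm _).trans ?_
  gcongr
  refine (ContinuousLinearMap.opNorm_comp_le _ _).trans ?_
  rw [A.curryLeft_norm]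

lemma norm_arensStep_le_of_le {n : ℕ} {u : Bidual X} {Φ : (X [×n]→L[ℂ] ℂ) →L[ℂ] ℂ} {C : ℝ}
    (hu : ‖u‖ ≤ 1) (hΦ : ‖Φ‖ ≤ C) : ‖arensStep u Φ‖ ≤ C :=
  (norm_arensStep_le u Φ).trans
    ((mul_le_of_le_one_left Φ.opNorm_nonneg hu).trans hΦ)

/-- The functional `A ↦ Ã(w, …, w)`. -/
def arensDiag (n : ℕ) (w : Bidual X) : (X [×n]→L[ℂ] ℂ) →L[ℂ] ℂ :=
  arensEval n fun _ => w

lemma arensDiag_succ (n : ℕ) (w : Bidual X) :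
    arensDiag (n + 1) w = arensStep w (arensDiag n w) := rfl

lemma arensDiag_zero (w : Bidual X) (A : X [×0]→L[ℂ] ℂ) : arensDiag 0 w A = A 0 := rfl

lemma norm_arensDiag_zero_le (w : Bidual X) :
    ‖(arensDiag 0 w : (X [×0]→L[ℂ] ℂ) →L[ℂ] ℂ)‖ ≤ 1 := by
  refine ContinuousLinearMap.opNorm_le_bound _ zero_le_one fun A => ?_
  rw [arensDiag_zero, one_mul]
  exact ContinuousMultilinearMap.fin0_apply_norm A |>.le

lemma norm_arensDiag_le (n : ℕ) {w : Bidual X} (hw : ‖w‖ ≤ 1) :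
    ‖(arensDiag n w : (X [×n]→L[ℂ] ℂ) →L[ℂ] ℂ)‖ ≤ 1 := by
  induction n with
  | zero => exact norm_arensDiag_zero_le w
  | succ n ih =>
    rw [arensDiag_succ]
    exact norm_arensStep_le_of_le hw ih

lemma continuous_arensDiag (n : ℕ) :
    Continuous (arensDiag n : Bidual X → (X [×n]→L[ℂ] ℂ) →L[ℂ] ℂ) := by
  induction n with
  | zero => exact continuous_const
  | succ n ih =>
    change Continuous fun w : Bidual X => arensStep w (arensDiag n w)
    unfold arensStep
    exact continuous_id.clm_comp
      (((ContinuousLinearMap.compL ℂ X (X [×n]→L[ℂ] ℂ) ℂ).continuous.comp ih).clm_comp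
        continuous_const)

lemma continuous_aronBerner (P : ContPoly X) : Continuous P.aronBerner := by
  unfold ContPoly.aronBerner
  exact continuous_finsetSum _ fun n _ => (continuous_arensDiag n).clm_apply continuous_const

lemma arensDiag_inclusion (n : ℕ) (x : X) (A : X [×n]→L[ℂ] ℂ) :
    arensDiag n (NormedSpace.inclusionInDoubleDual ℂ X x) A = A fun _ => x := by
  induction n with
  | zero => rw [arensDiag_zero]; congr 1; exact Subsingleton.elim _ _
  | succ n ih =>
    rw [arensDiag_succ, arensStep_apply, NormedSpace.dual_def]
    change arensDiag n _ (A.curryLeft x) = _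
    rw [ih, ContinuousMultilinearMap.curryLeft_apply]
    congr 1
    ext i
    refine Fin.cases ?_ (fun j => ?_) i <;> simp

lemma aronBerner_inclusion (P : ContPoly X) (x : X) :
    P.aronBerner (NormedSpace.inclusionInDoubleDual ℂ X x) = P.eval x :=
  Finset.sum_congr rfl fun n _ => arensDiag_inclusion n x (P.form n)

lemma aronBernerHom_smul (n : ℕ) (A : X [×n]→L[ℂ] ℂ) (s : ℂ) (z : Bidual X) :
    aronBernerHom n (s • A) z = s * aronBernerHom n A z := by
  simp [aronBernerHom]

/-! ### First-order expansion of the Aron-Berner extension -/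

/-- The derivative at `w` in the direction `u` of `w ↦ Ã(w, …, w)`, as a functional of `A`. -/
def arensDeriv : (n : ℕ) → Bidual X → Bidual X → ((X [×n]→L[ℂ] ℂ) →L[ℂ] ℂ)
  | 0, _, _ => 0
  | n + 1, w, u => arensStep u (arensDiag n w) + arensStep w (arensDeriv n w u)

lemma norm_arensDeriv_le (n : ℕ) {w u : Bidual X} (hw : ‖w‖ ≤ 1) (hu : ‖u‖ ≤ 1) :
    ‖(arensDeriv n w u : (X [×n]→L[ℂ] ℂ) →L[ℂ] ℂ)‖ ≤ n := by
  induction n with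
  | zero => exact ContinuousLinearMap.opNorm_zero.trans_le (by simp)
  | succ n ih =>
    rw [arensDeriv]
    have h1 := norm_arensStep_le_of_le hu (norm_arensDiag_le n hw)
    have h2 := norm_arensStep_le_of_le hw ih
    push_cast
    linarith [norm_add_le (arensStep u (arensDiag n w)) (arensStep w (arensDeriv n w u))]

/-- The remainder of the first-order expansion of `Ã(w, …, w)` is quadratic, uniformly on the
unit ball. -/
lemma exists_norm_arensDiag_sub_le (X : Type*) [NormedAddCommGroup X] [NormedSpace ℂ X] (n : ℕ) :
    ∃ C : ℝ, 0 ≤ C ∧ ∀ (w u : Bidual X) (t : ℝ), ‖w‖ ≤ 1 → ‖u‖ ≤ 1 → 0 ≤ t → t ≤ 1 →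
      ‖(arensDiag n (w + (t : ℂ) • u) - arensDiag n w - (t : ℂ) • arensDeriv n w u :
        (X [×n]→L[ℂ] ℂ) →L[ℂ] ℂ)‖ ≤ C * t ^ 2 := by
  induction n with
  | zero =>
    refine ⟨0, le_rfl, fun w u t _ _ _ _ => ?_⟩
    have : (arensDiag 0 (w + (t : ℂ) • u) - arensDiag 0 w - (t : ℂ) • arensDeriv 0 w u :
        (X [×0]→L[ℂ] ℂ) →L[ℂ] ℂ) = 0 := by
      ext A; simp [arensDiag_zero, arensDeriv]
    rw [this]
    exact ContinuousLinearMap.opNorm_zero.trans_le (by simp)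
  | succ n ih =>
    obtain ⟨C, hC, h⟩ := ih
    refine ⟨2 * C + n, by positivity, fun w u t hw hu ht ht1 => ?_⟩
    set R := (arensDiag n (w + (t : ℂ) • u) - arensDiag n w - (t : ℂ) • arensDeriv n w u :
        (X [×n]→L[ℂ] ℂ) →L[ℂ] ℂ) with hR
    have hRn : ‖R‖ ≤ C * t ^ 2 := h w u t hw hu ht ht1
    have hdiag : arensDiag n (w + (t : ℂ) • u) =
        arensDiag n w + (t : ℂ) • arensDeriv n w u + R := by rw [hR]; abel
    have key : (arensDiag (n + 1) (w + (t : ℂ) • u) - arensDiag (n + 1) w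
        - (t : ℂ) • arensDeriv (n + 1) w u : (X [×(n + 1)]→L[ℂ] ℂ) →L[ℂ] ℂ) =
        arensStep w R + (t : ℂ) • arensStep u R
          + ((t : ℂ) * t) • arensStep u (arensDeriv n w u) := by
      rw [arensDiag_succ, arensDiag_succ, arensDeriv, hdiag]
      simp only [arensStep_add_left, arensStep_add_right, arensStep_smul_left,
        arensStep_smul_right, smul_add, smul_smul]
      abel
    rw [key]
    have n1 : ‖arensStep w R‖ ≤ C * t ^ 2 :=
      norm_arensStep_le_of_le hw hRn
    have n2 : ‖(t : ℂ) • arensStep u R‖ ≤ C * t ^ 2 := by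
      refine (ContinuousLinearMap.opNorm_smul_le _ _).trans ?_
      rw [Complex.norm_of_nonneg ht]
      refine (mul_le_of_le_one_left (ContinuousLinearMap.opNorm_nonneg _) ht1).trans ?_
      exact norm_arensStep_le_of_le hu hRn
    have n3 : ‖((t : ℂ) * t) • arensStep u (arensDeriv n w u)‖ ≤ n * t ^ 2 := by
      refine (ContinuousLinearMap.opNorm_smul_le _ _).trans ?_
      rw [norm_mul, Complex.norm_of_nonneg ht, ← sq, mul_comm]
      gcongr
      exact norm_arensStep_le_of_le hu (norm_arensDeriv_le n hw hu)
    have n4 := ContinuousLinearMap.opNorm_add_le (arensStep w R) ((t : ℂ) • arensStep u R)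
    refine (ContinuousLinearMap.opNorm_add_le _ _).trans ?_
    linarith

/-! ### Commuting variables of symmetric forms -/

/-- Symmetry of a continuous multilinear form. -/
def IsSymmForm {n : ℕ} (A : X [×n]→L[ℂ] ℂ) : Prop :=
  ∀ (σ : Equiv.Perm (Fin n)) (v : Fin n → X), A (v ∘ σ) = A v

lemma IsSymmForm.curryLeft {n : ℕ} {A : X [×(n + 1)]→L[ℂ] ℂ} (hA : IsSymmForm A) (x : X) :
    IsSymmForm (A.curryLeft x) := by
  intro σ v
  simp only [ContinuousMultilinearMap.curryLeft_apply]
  -- the permutation of `Fin (n + 1)` that fixes `0` and acts as `σ` on the other indices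
  rw [← hA (Equiv.Perm.decomposeFin.symm (0, σ)) (Fin.cons x v)]
  congr 1
  ext i
  refine Fin.cases ?_ (fun j => ?_) i <;> simp

lemma IsSymmForm.curryLeft_comm {n : ℕ} {A : X [×(n + 2)]→L[ℂ] ℂ} (hA : IsSymmForm A)
    (x y : X) : (A.curryLeft x).curryLeft y = (A.curryLeft y).curryLeft x := by
  ext v
  simp only [ContinuousMultilinearMap.curryLeft_apply]
  rw [← hA (Equiv.swap 0 1)]
  congr 1
  ext i
  refine Fin.cases ?_ (fun j => ?_) i
  · rfl
  · refine Fin.cases ?_ (fun k => ?_) j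
    · rfl
    · have : Equiv.swap (0 : Fin (n + 2)) 1 k.succ.succ = k.succ.succ :=
        Equiv.swap_apply_of_ne_of_ne (Fin.succ_ne_zero _) (by simp [Fin.ext_iff])
      simp [this]

/-- A variable in `X` commutes with any other one. In general two variables in the bidual do not
commute, as `X` need not be Arens regular. -/
lemma IsSymmForm.arensStep_inclusion_comm {n : ℕ} {A : X [×(n + 2)]→L[ℂ] ℂ} (hA : IsSymmForm A)
    (x : X) (b : Bidual X) (Φ : (X [×n]→L[ℂ] ℂ) →L[ℂ] ℂ) :
    arensStep (NormedSpace.inclusionInDoubleDual ℂ X x) (arensStep b Φ) A =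
      arensStep b (arensStep (NormedSpace.inclusionInDoubleDual ℂ X x) Φ) A := by
  rw [arensStep_apply, arensStep_apply, NormedSpace.dual_def]
  change b (Φ.comp (A.curryLeft x).curryLeft) = _
  congr 1
  ext y
  change Φ ((A.curryLeft x).curryLeft y) = Φ ((A.curryLeft y).curryLeft x)
  rw [hA.curryLeft_comm]

/-- Two variables of the form `J x + s z`, with the same `z`, commute. -/
lemma IsSymmForm.arensStep_comm {n : ℕ} {A : X [×(n + 2)]→L[ℂ] ℂ} (hA : IsSymmForm A)
    (x y : X) (s t : ℂ) (z : Bidual X) (Φ : (X [×n]→L[ℂ] ℂ) →L[ℂ] ℂ) :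
    arensStep (NormedSpace.inclusionInDoubleDual ℂ X x + s • z)
      (arensStep (NormedSpace.inclusionInDoubleDual ℂ X y + t • z) Φ) A =
    arensStep (NormedSpace.inclusionInDoubleDual ℂ X y + t • z)
      (arensStep (NormedSpace.inclusionInDoubleDual ℂ X x + s • z) Φ) A := by
  have h := hA.arensStep_inclusion_comm x (NormedSpace.inclusionInDoubleDual ℂ X y) Φ
  have h1 := hA.arensStep_inclusion_comm x z Φ
  have h2 := hA.arensStep_inclusion_comm y z Φ
  simp only [arensStep_add_left, arensStep_add_right, arensStep_smul_left,
    arensStep_smul_right, add_apply, smul_apply, smul_eq_mul]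
  rw [h, h1, h2]
  ring

/-- For points and directions in `X + ℂ z`, all the terms of the product rule for the derivative of
`w ↦ Ã(w, …, w)` agree with the one that has the direction `u` as the outermost variable. Thus the
derivative is the value of `u` at a functional that does not depend on `u`. -/
lemma IsSymmForm.arensDeriv_succ {n : ℕ} {A : X [×(n + 1)]→L[ℂ] ℂ} (hA : IsSymmForm A)
    (x y : X) (s t : ℂ) (z : Bidual X) :
    arensDeriv (n + 1) (NormedSpace.inclusionInDoubleDual ℂ X x + s • z)
      (NormedSpace.inclusionInDoubleDual ℂ X y + t • z) A =
    (n + 1) * arensStep (NormedSpace.inclusionInDoubleDual ℂ X y + t • z)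
      (arensDiag n (NormedSpace.inclusionInDoubleDual ℂ X x + s • z)) A := by
  set w := NormedSpace.inclusionInDoubleDual ℂ X x + s • z with hw
  set u := NormedSpace.inclusionInDoubleDual ℂ X y + t • z with hu
  induction n with
  | zero =>
    have : arensStep w (arensDeriv 0 w u) A = 0 := by simp [arensStep_apply, arensDeriv]
    rw [arensDeriv, add_apply, this]
    simp
  | succ n ih =>
    have h : arensStep w (arensDeriv (n + 1) w u) A =
        (n + 1) * arensStep w (arensStep u (arensDiag n w)) A := by
      rw [arensStep_apply, arensStep_apply, ← smul_eq_mul, ← map_smul]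
      congr 1
      ext v
      exact ih (hA.curryLeft v)
    rw [arensDeriv, add_apply, h, hA.arensStep_comm, ← hu, ← arensDiag_succ]
    push_cast
    ring

/-! ### The Aron-Berner extension is norm-preserving -/

local notation "J" => NormedSpace.inclusionInDoubleDual ℂ X

/-- The case of a single functional of Goldstine's theorem, with equality instead of
approximation. -/
lemma exists_norm_lt_apply_eq {z : Bidual X} {r : ℝ} (hz : ‖z‖ < r) (ℓ : StrongDual ℂ X) :
    ∃ x : X, ‖x‖ < r ∧ ℓ x = z ℓ := by
  have hr : 0 < r := (norm_nonneg z).trans_lt hz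
  by_cases h0 : z ℓ = 0
  · exact ⟨0, by simpa using hr, by simp [h0]⟩
  have hl : 0 < ‖ℓ‖ := norm_pos_iff.2 fun h => h0 (by simp [h])
  have hlt : ‖z ℓ‖ / r < ‖ℓ‖ := by
    rw [div_lt_iff₀' hr]
    exact (z.le_opNorm ℓ).trans_lt (by gcongr)
  obtain ⟨y, hy, hly⟩ := ℓ.exists_lt_apply_of_lt_opNorm hlt
  have hpos : 0 < ‖ℓ y‖ := lt_of_le_of_lt (by positivity) hly
  refine ⟨(z ℓ / ℓ y) • y, ?_, ?_⟩
  · rw [norm_smul, norm_div]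
    have h1 : ‖z ℓ‖ / ‖ℓ y‖ < r := by
      rw [div_lt_iff₀ hpos]
      rwa [div_lt_iff₀' hr] at hly
    exact (mul_le_of_le_one_right (by positivity) hy.le).trans_lt h1
  · rw [map_smul, smul_eq_mul, div_mul_cancel₀]
    exact norm_pos_iff.1 hpos

/-- At a point of `X + ℂ z`, the derivative of `w ↦ Ã(w, …, w)` in the directions of `X + ℂ z` is
evaluation at a single functional on `X`. -/
lemma IsSymmForm.exists_arensDeriv_eq {n : ℕ} {A : X [×n]→L[ℂ] ℂ} (hA : IsSymmForm A)
    (x : X) (s : ℂ) (z : Bidual X) :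
    ∃ ℓ : StrongDual ℂ X, ∀ (y : X) (t : ℂ),
      arensDeriv n (J x + s • z) (J y + t • z) A = (J y + t • z) ℓ := by
  cases n with
  | zero => exact ⟨0, fun y t => by rw [map_zero]; rfl⟩
  | succ n =>
    refine ⟨((n : ℂ) + 1) • (arensDiag n (J x + s • z)).comp A.curryLeft, fun y t => ?_⟩
    rw [hA.arensDeriv_succ, map_smul, arensStep_apply, smul_eq_mul]

/-- A small increment `t z` of the argument of the Aron-Berner extension can be replaced, up to an
error of second order, by an increment in `X`. -/
lemma ContPoly.exists_aronBerner_step (P : ContPoly X) :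
    ∃ K : ℝ, 0 ≤ K ∧ ∀ (y : X) (s : ℂ) (z : Bidual X) (r t : ℝ),
      ‖J y + s • z‖ ≤ 1 → ‖z‖ < r → r ≤ 1 → 0 ≤ t → t ≤ 1 →
      ∃ x : X, ‖x‖ < r ∧ ‖P.aronBerner (J y + s • z + (t : ℂ) • z) -
        P.aronBerner (J y + s • z + (t : ℂ) • J x)‖ ≤ K * t ^ 2 := by
  choose C hC0 hC using exists_norm_arensDiag_sub_le X
  refine ⟨∑ n ∈ Finset.range (P.deg + 1), 2 * C n * ‖P.form n‖,
    Finset.sum_nonneg fun n _ => by have := hC0 n; positivity,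
    fun y s z r t hw hz hr ht ht1 => ?_⟩
  choose ℓ hl using fun n => IsSymmForm.exists_arensDeriv_eq (P.symm n) y s z
  -- the single functional that has to agree at `x` and at `z`
  obtain ⟨x, hx, hxz⟩ := exists_norm_lt_apply_eq hz (∑ n ∈ Finset.range (P.deg + 1), ℓ n)
  refine ⟨x, hx, ?_⟩
  set w := J y + s • z with hwdef
  have hz1 : ‖z‖ ≤ 1 := hz.le.trans hr
  have hx1 : ‖J x‖ ≤ 1 :=
    (NormedSpace.double_dual_bound ℂ X x).trans (hx.le.trans hr)
  have hDz : ∀ n, arensDeriv n w z (P.form n) = z (ℓ n) := fun n => by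
    simpa using hl n 0 1
  have hDx : ∀ n, arensDeriv n w (J x) (P.form n) = ℓ n x := fun n => by
    have h := hl n x 0
    rwa [zero_smul ℂ z, add_zero] at h
  have hsum : ∑ n ∈ Finset.range (P.deg + 1), ℓ n x =
      ∑ n ∈ Finset.range (P.deg + 1), z (ℓ n) := by
    rw [← map_sum, ← hxz]; simp
  have key : P.aronBerner (w + (t : ℂ) • z) - P.aronBerner (w + (t : ℂ) • J x) =
      ∑ n ∈ Finset.range (P.deg + 1),
        ((arensDiag n (w + (t : ℂ) • z) - arensDiag n w - (t : ℂ) • arensDeriv n w z)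
          (P.form n) -
        (arensDiag n (w + (t : ℂ) • J x) - arensDiag n w - (t : ℂ) • arensDeriv n w (J x))
          (P.form n)) := by
    have h0 : (t : ℂ) * (∑ n ∈ Finset.range (P.deg + 1), ℓ n x) -
        t * ∑ n ∈ Finset.range (P.deg + 1), z (ℓ n) = 0 := by rw [hsum, sub_self]
    rw [← add_zero (P.aronBerner (w + (t : ℂ) • z) - _), ← h0]
    simp only [ContPoly.aronBerner, Finset.mul_sum, ← Finset.sum_sub_distrib,
      ← Finset.sum_add_distrib]
    refine Finset.sum_congr rfl fun n _ => ?_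
    simp only [sub_apply, smul_apply, hDz, hDx, smul_eq_mul]
    simp only [aronBernerHom, arensDiag]
    ring
  rw [key, Finset.sum_mul]
  refine norm_sum_le_of_le _ fun n _ => ?_
  have b1 := ContinuousLinearMap.le_of_opNorm_le _ (hC n w z t hw hz1 ht ht1) (P.form n)
  have b2 := ContinuousLinearMap.le_of_opNorm_le _ (hC n w (J x) t hw hx1 ht ht1) (P.form n)
  refine (norm_sub_le _ _).trans ?_
  linarith

/-- The theorem of Davie and Gamelin: a bound for a polynomial on the ball of radius `r` also holds
for its Aron-Berner extension on the ball of radius `r` of the bidual. Walking from `z` to a point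
of `X` in `N` steps, each of which replaces `z / N` by some `x / N`, costs `O(1 / N)`. -/
theorem ContPoly.norm_aronBerner_le (P : ContPoly X) {r M : ℝ} (hr : r ≤ 1)
    (hM : ∀ x : X, ‖x‖ < r → ‖P.eval x‖ ≤ M) {z : Bidual X} (hz : ‖z‖ < r) :
    ‖P.aronBerner z‖ ≤ M := by
  obtain ⟨K, hK, hstep⟩ := P.exists_aronBerner_step
  obtain ⟨q, hzq, hqr⟩ := exists_between hz
  have hq0 : 0 < q := (norm_nonneg z).trans_lt hzq
  have hq1 : q ≤ 1 := hqr.le.trans hr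
  -- after `k` steps the walk is at `J y + ((N - k) / N) z`, of norm at most `q`
  have walk : ∀ N : ℕ, 0 < N → ∀ k : ℕ, k ≤ N → ∃ y : X, ‖y‖ ≤ k / N * q ∧
      ‖P.aronBerner z - P.aronBerner (J y + (((N - k : ℝ) / N : ℝ) : ℂ) • z)‖ ≤
        k * (K * (1 / N : ℝ) ^ 2) := by
    intro N hN k
    have hN' : (0 : ℝ) < N := by exact_mod_cast hN
    induction k with
    | zero =>
      intro _
      refine ⟨0, by simp, ?_⟩
      rw [Nat.cast_zero, sub_zero, div_self hN'.ne', Complex.ofReal_one, one_smul ℂ z, map_zero,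
        zero_add, sub_self]
      simp
    | succ k ih =>
      intro hk
      obtain ⟨y, hy, hyP⟩ := ih (Nat.le_of_succ_le hk)
      have hk' : (k : ℝ) + 1 ≤ N := by exact_mod_cast hk
      set s : ℝ := (N - (k + 1 : ℕ) : ℝ) / N with hs
      have hs0 : 0 ≤ s := div_nonneg (by push_cast; linarith) hN'.le
      have hsk : (N - k : ℝ) / N = s + 1 / N := by rw [hs]; push_cast; ring
      have hks : (k : ℝ) / N + s ≤ 1 := by
        rw [hs, ← add_div, div_le_one hN']; push_cast; linarith
      have hw : ‖J y + (s : ℂ) • z‖ ≤ 1 := by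
        refine (ContinuousLinearMap.opNorm_add_le _ _).trans ?_
        refine (add_le_add_right (ContinuousLinearMap.opNorm_smul_le _ _) _).trans ?_
        rw [Complex.norm_of_nonneg hs0]
        calc ‖J y‖ + s * ‖z‖ ≤ k / N * q + s * q := by
              gcongr
              exact (NormedSpace.double_dual_bound ℂ X y).trans hy
          _ = (k / N + s) * q := by ring
          _ ≤ 1 * q := by gcongr
          _ ≤ 1 := by linarith
      have hN1 : 1 / (N : ℝ) ≤ 1 := by
        rw [div_le_one hN']; exact_mod_cast hN
      obtain ⟨x, hx, hxP⟩ := hstep y s z q (1 / N) hw hzq hq1 (by positivity) hN1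
      refine ⟨y + ((1 / N : ℝ) : ℂ) • x, ?_, ?_⟩
      · refine (norm_add_le _ _).trans ?_
        rw [norm_smul, Complex.norm_of_nonneg (by positivity)]
        calc ‖y‖ + 1 / N * ‖x‖ ≤ k / N * q + 1 / N * q := by gcongr
          _ = _ := by push_cast; ring
      · have e1 : J y + (((N - k : ℝ) / N : ℝ) : ℂ) • z =
            J y + (s : ℂ) • z + ((1 / N : ℝ) : ℂ) • z := by
          rw [hsk, Complex.ofReal_add, add_smul _ _ z, add_assoc]
        have e2 : J (y + ((1 / N : ℝ) : ℂ) • x) + (s : ℂ) • z =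
            J y + (s : ℂ) • z + ((1 / N : ℝ) : ℂ) • J x := by
          rw [map_add, map_smul]; abel
        rw [e1] at hyP
        rw [e2]
        refine (norm_sub_le_norm_sub_add_norm_sub _ _ _).trans ((add_le_add hyP hxP).trans ?_)
        push_cast
        exact le_of_eq (by ring)
  refine le_of_forall_pos_le_add fun ε hε => ?_
  obtain ⟨N, hN⟩ := exists_nat_gt (max (K / ε) 0)
  have hN' : (0 : ℝ) < N := (le_max_right _ _).trans_lt hN
  obtain ⟨y, hy, hyP⟩ := walk N (by exact_mod_cast hN') N le_rfl
  rw [div_self hN'.ne', one_mul] at hy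
  rw [sub_self, zero_div, Complex.ofReal_zero, zero_smul ℂ z, add_zero, aronBerner_inclusion] at hyP
  have hle : (N : ℝ) * (K * (1 / N) ^ 2) ≤ ε := by
    have h1 : K / ε < N := (le_max_left _ _).trans_lt hN
    rw [div_lt_iff₀ hε] at h1
    have h2 : (N : ℝ) * (K * (1 / N) ^ 2) = K / N := by field_simp
    rw [h2, div_le_iff₀ hN']
    linarith
  have h3 := norm_le_norm_add_norm_sub (P.eval y) (P.aronBerner z)
  rw [norm_sub_rev] at hyP
  linarith [hM y (hy.trans_lt hqr), norm_sub_rev (P.eval y) (P.aronBerner z)]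

/-! ### Taylor series of bounded holomorphic functions on the ball -/

lemma zeroExt_coe {E : Type*} [NormedAddCommGroup E] (g : UnitBall E →ᵇ ℂ) (x : UnitBall E) :
    zeroExt g x = g x :=
  Subtype.val_injective.extend_apply _ _ _

lemma norm_zeroExt_le {E : Type*} [NormedAddCommGroup E] (g : UnitBall E →ᵇ ℂ) (x : E) :
    ‖zeroExt g x‖ ≤ ‖g‖ := by
  by_cases hx : ∃ y : UnitBall E, (y : E) = x
  · obtain ⟨y, rfl⟩ := hx
    rw [zeroExt_coe]
    exact g.norm_coe_le_norm y
  · rw [zeroExt, Function.extend_apply' _ _ _ hx]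
    simp

lemma isSymmForm_taylorForm {g : UnitBall X →ᵇ ℂ} (hg : g ∈ HInfty X) (n : ℕ) :
    IsSymmForm (taylorForm g n) := by
  intro σ v
  have h : ContDiffAt ℂ ⊤ (zeroExt g) 0 := (hg 0 (by simp)).contDiffAt
  simp only [taylorForm, smul_apply, h.iteratedFDeriv_comp_perm]

lemma differentiableOn_zeroExt_smul {g : UnitBall X →ᵇ ℂ} (hg : g ∈ HInfty X) {x : X} {R : ℝ}
    (hR : R * ‖x‖ ≤ 1) : DifferentiableOn ℂ (fun ζ : ℂ => zeroExt g (ζ • x)) (ball 0 R) := by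
  refine hg.differentiableOn.comp (by fun_prop) fun ζ hζ => ?_
  rw [mem_ball_zero_iff] at hζ ⊢
  rw [norm_smul]
  rcases eq_or_ne x 0 with rfl | hx
  · simp
  · exact (mul_lt_mul_of_pos_right hζ (norm_pos_iff.2 hx)).trans_le hR

/-- The Taylor polynomials of `g` at `x` are the Taylor coefficients of `ζ ↦ g (ζ x)`. -/
lemma taylorForm_diag {g : UnitBall X →ᵇ ℂ} (hg : g ∈ HInfty X) (n : ℕ) (x : X) :
    taylorForm g n (fun _ => x) =
      (n ! : ℂ)⁻¹ * iteratedDeriv n (fun ζ : ℂ => zeroExt g (ζ • x)) 0 := by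
  let L : ℂ →L[ℂ] X := ContinuousLinearMap.toSpanSingleton ℂ x
  have hopen : IsOpen (L ⁻¹' ball (0 : X) 1) := isOpen_ball.preimage L.continuous
  have hL0 : L 0 ∈ ball (0 : X) 1 := by simp
  have h := L.iteratedFDerivWithin_comp_right (f := zeroExt g) (s := ball (0 : X) 1) (n := ⊤)
    (hg.contDiffOn isOpen_ball.uniqueDiffOn) isOpen_ball.uniqueDiffOn hopen.uniqueDiffOn hL0
    (i := n) le_top
  rw [iteratedFDerivWithin_of_isOpen n hopen hL0,
    iteratedFDerivWithin_of_isOpen n isOpen_ball hL0, map_zero] at h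
  have h' : (fun ζ : ℂ => zeroExt g (ζ • x)) = zeroExt g ∘ L := by
    ext ζ; simp [L]
  rw [iteratedDeriv_eq_iteratedFDeriv, h', h, taylorForm]
  simp [L]

lemma taylorForm_smul_diag (g : UnitBall X →ᵇ ℂ) (n : ℕ) (s : ℂ) (x : X) :
    taylorForm g n (fun _ => s • x) = s ^ n * taylorForm g n (fun _ => x) := by
  simpa using (taylorForm g n).map_smul_univ (fun _ => s) (fun _ => x)

lemma hasSum_taylorForm {g : UnitBall X →ᵇ ℂ} (hg : g ∈ HInfty X) {x : X} (hx : ‖x‖ < 1) :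
    HasSum (fun n => taylorForm g n fun _ => x) (zeroExt g x) := by
  -- `ζ ↦ g (ζ x)` is holomorphic on a disc of radius `2 / (1 + ‖x‖) > 1`
  have hpos : 0 < 1 + ‖x‖ := by positivity
  have hR : 2 / (1 + ‖x‖) * ‖x‖ ≤ 1 := by
    rw [div_mul_eq_mul_div, div_le_one hpos]; linarith
  have hR1 : (1 : ℂ) ∈ ball (0 : ℂ) (2 / (1 + ‖x‖)) := by
    rw [mem_ball_zero_iff, norm_one, lt_div_iff₀ hpos]; linarith
  have h := Complex.hasSum_taylorSeries_on_ball (differentiableOn_zeroExt_smul hg hR) hR1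
  simp only [one_smul, sub_zero, one_pow, smul_eq_mul, one_mul] at h
  simpa only [taylorForm_diag hg] using h

/-- Cauchy's estimate. -/
lemma norm_taylorForm_diag_le {g : UnitBall X →ᵇ ℂ} (hg : g ∈ HInfty X) (n : ℕ) {x : X}
    (hx : ‖x‖ < 1) : ‖taylorForm g n fun _ => x‖ ≤ ‖g‖ := by
  have hpos : 0 < 1 + ‖x‖ := by positivity
  have hR : 2 / (1 + ‖x‖) * ‖x‖ ≤ 1 := by
    rw [div_mul_eq_mul_div, div_le_one hpos]; linarith
  have hR1 : 1 < 2 / (1 + ‖x‖) := by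
    rw [lt_div_iff₀ hpos]; linarith
  have hd : DiffContOnCl ℂ (fun ζ : ℂ => zeroExt g (ζ • x)) (ball 0 1) :=
    (differentiableOn_zeroExt_smul hg hR).diffContOnCl_ball (closedBall_subset_ball hR1)
  have h := Complex.norm_iteratedDeriv_le_of_forall_mem_sphere_norm_le n one_pos hd
    fun ζ _ => norm_zeroExt_le g (ζ • x)
  rw [taylorForm_diag hg, norm_mul, norm_inv, Complex.norm_natCast,
    inv_mul_le_iff₀ (by positivity)]
  simpa using h

/-- Cauchy's estimate at points of the ball of radius `r`, by homogeneity. -/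
lemma norm_taylorForm_diag_le_pow {g : UnitBall X →ᵇ ℂ} (hg : g ∈ HInfty X) (n : ℕ) {x : X}
    {r : ℝ} (hx : ‖x‖ < r) : ‖taylorForm g n fun _ => x‖ ≤ ‖g‖ * r ^ n := by
  have hr : 0 < r := (norm_nonneg x).trans_lt hx
  have hr' : (r : ℂ) ≠ 0 := by exact_mod_cast hr.ne'
  have hy : ‖((r : ℂ)⁻¹ • x)‖ < 1 := by
    rwa [norm_smul, norm_inv, Complex.norm_of_nonneg hr.le, inv_mul_lt_iff₀ hr, mul_one]
  have hxy : (r : ℂ) • (r : ℂ)⁻¹ • x = x := smul_inv_smul₀ hr' x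
  rw [← hxy, taylorForm_smul_diag, norm_mul, norm_pow, Complex.norm_of_nonneg hr.le, mul_comm]
  gcongr
  exact norm_taylorForm_diag_le hg n hy

/-- The polynomial `∑_{n ≤ N} c n • P n`, where the `P n` are the Taylor polynomials of `g`
at `0`. -/
def weightedTaylor (g : UnitBall X →ᵇ ℂ) (hg : g ∈ HInfty X) (c : ℕ → ℂ) (N : ℕ) :
    ContPoly X where
  deg := N
  form n := c n • taylorForm g n
  symm n σ v := by simp only [smul_apply, isSymmForm_taylorForm hg n σ v]

lemma weightedTaylor_eval (g : UnitBall X →ᵇ ℂ) (hg : g ∈ HInfty X) (c : ℕ → ℂ) (N : ℕ)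
    (x : X) : (weightedTaylor g hg c N).eval x =
      ∑ n ∈ Finset.range (N + 1), c n * taylorForm g n fun _ => x := rfl

lemma weightedTaylor_aronBerner (g : UnitBall X →ᵇ ℂ) (hg : g ∈ HInfty X) (c : ℕ → ℂ) (N : ℕ)
    (z : Bidual X) : (weightedTaylor g hg c N).aronBerner z =
      ∑ n ∈ Finset.range (N + 1), c n * aronBernerHom n (taylorForm g n) z :=
  Finset.sum_congr rfl fun n _ => aronBernerHom_smul n (taylorForm g n) (c n) z

lemma norm_taylor_sub_le {g : UnitBall X →ᵇ ℂ} (hg : g ∈ HInfty X) {x : X} {q : ℝ}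
    (hx : ‖x‖ < q) (hq : q < 1) (N : ℕ) :
    ‖∑ n ∈ Finset.range N, taylorForm g n (fun _ => x) - zeroExt g x‖ ≤
      ‖g‖ * q ^ N / (1 - q) :=
  norm_sub_le_of_geometric_bound_of_hasSum hq
    (fun n => norm_taylorForm_diag_le_pow hg n hx) (hasSum_taylorForm hg (hx.trans hq)) N

/-! ### The Aron-Berner extension of holomorphic functions -/

lemma aronBernerHom_smul_arg (n : ℕ) (A : X [×n]→L[ℂ] ℂ) (s : ℂ) (z : Bidual X) :
    aronBernerHom n A (s • z) = s ^ n * aronBernerHom n A z := by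
  change arensDiag n (s • z) A = s ^ n * arensDiag n z A
  induction n with
  | zero => simp [arensDiag_zero]
  | succ n ih =>
    have h : (arensDiag n (s • z)).comp A.curryLeft =
        s ^ n • (arensDiag n z).comp A.curryLeft := by
      ext x; exact ih (A.curryLeft x)
    rw [arensDiag_succ, arensDiag_succ, arensStep_apply, arensStep_apply, h, map_smul]
    simp only [smul_apply, smul_eq_mul]
    ring

/-- By the theorem of Davie and Gamelin, Cauchy's estimate also holds in the bidual, without the loss
of a factor `n ^ n / n!` that a bound by the norm of the multilinear form would cause. -/
lemma norm_aronBernerHom_taylorForm_le {g : UnitBall X →ᵇ ℂ} (hg : g ∈ HInfty X) (n : ℕ)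
    {z : Bidual X} {q : ℝ} (hz : ‖z‖ < q) (hq : q ≤ 1) :
    ‖aronBernerHom n (taylorForm g n) z‖ ≤ ‖g‖ * q ^ n := by
  have h := (weightedTaylor g hg (fun k => if k = n then 1 else 0) n).norm_aronBerner_le
    (M := ‖g‖ * q ^ n) hq (fun x hx => ?_) hz
  · simpa [weightedTaylor_aronBerner] using h
  · simpa [weightedTaylor_eval] using norm_taylorForm_diag_le_pow hg n hx

lemma hasSum_aronBernerBall {g : UnitBall X →ᵇ ℂ} (hg : g ∈ HInfty X) {z : Bidual X}
    (hz : ‖z‖ < 1) :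
    HasSum (fun n => aronBernerHom n (taylorForm g n) z) (aronBernerBall g z) := by
  obtain ⟨q, hzq, hq⟩ := exists_between hz
  refine Summable.hasSum (Summable.of_norm_bounded ?_
    fun n => norm_aronBernerHom_taylorForm_le hg n hzq hq.le)
  exact (summable_geometric_of_lt_one ((norm_nonneg z).trans hzq.le) hq).mul_left _

lemma norm_aronBernerHom_sum_sub_le {g : UnitBall X →ᵇ ℂ} (hg : g ∈ HInfty X) {z : Bidual X}
    {q : ℝ} (hz : ‖z‖ < q) (hq : q < 1) (N : ℕ) :
    ‖∑ n ∈ Finset.range N, aronBernerHom n (taylorForm g n) z - aronBernerBall g z‖ ≤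
      ‖g‖ * q ^ N / (1 - q) :=
  norm_sub_le_of_geometric_bound_of_hasSum hq
    (fun n => norm_aronBernerHom_taylorForm_le hg n hz hq.le)
    (hasSum_aronBernerBall hg (hz.trans hq)) N

lemma norm_real_smul_lt {E : Type*} [NormedAddCommGroup E] [NormedSpace ℂ E] {r q : ℝ}
    (hr0 : 0 < r) (x : E) (hx : ‖x‖ < q) : ‖(r : ℂ) • x‖ < r * q := by
  rw [norm_smul, Complex.norm_of_nonneg hr0.le]
  exact mul_lt_mul_of_pos_left hx hr0

/-- If `g` is close to its dilation `x ↦ g (r x)` on the unit ball, then so are their Aron-Berner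
extensions. -/
lemma norm_aronBernerBall_sub_dilation_le {g : UnitBall X →ᵇ ℂ} (hg : g ∈ HInfty X) {r ε : ℝ}
    (hr0 : 0 < r) (hr1 : r < 1)
    (hε : ∀ x : X, ‖x‖ < 1 → ‖zeroExt g x - zeroExt g ((r : ℂ) • x)‖ ≤ ε)
    {z : Bidual X} (hz : ‖z‖ < 1) :
    ‖aronBernerBall g z - aronBernerBall g ((r : ℂ) • z)‖ ≤ ε := by
  obtain ⟨q, hzq, hq⟩ := exists_between hz
  have hq0 : 0 < q := (norm_nonneg z).trans_lt hzq
  have hrq : r * q < q := mul_lt_of_lt_one_left hq0 hr1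
  have hrz : ‖(r : ℂ) • z‖ < 1 := ((norm_real_smul_lt hr0 z hzq).trans hrq).trans hq
  have hL : Tendsto (fun N : ℕ => ‖∑ n ∈ Finset.range (N + 1),
      (1 - (r : ℂ) ^ n) * aronBernerHom n (taylorForm g n) z‖) atTop
      (𝓝 ‖aronBernerBall g z - aronBernerBall g ((r : ℂ) • z)‖) := by
    have h := ((hasSum_aronBernerBall hg hz).sub (hasSum_aronBernerBall hg hrz)).tendsto_sum_nat
    refine ((tendsto_add_atTop_iff_nat 1).2 h).norm.congr fun N => ?_
    congr 1
    refine Finset.sum_congr rfl fun n _ => ?_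
    rw [aronBernerHom_smul_arg]; ring
  have hRt : Tendsto (fun N : ℕ => ε + 2 * (‖g‖ * q ^ (N + 1) / (1 - q))) atTop (𝓝 ε) := by
    have h := (tendsto_pow_atTop_nhds_zero_of_lt_one hq0.le hq).comp (tendsto_add_atTop_nat 1)
    have h2 := (((h.const_mul ‖g‖).div_const (1 - q)).const_mul 2).const_add ε
    simpa using h2
  -- the theorem of Davie and Gamelin for the truncation at `N` of the series of `g x - g (r x)`
  refine le_of_tendsto_of_tendsto' hL hRt fun N => ?_
  rw [← weightedTaylor_aronBerner g hg]
  refine ContPoly.norm_aronBerner_le _ hq.le (fun x hx => ?_) hzq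
  have h1 := norm_taylor_sub_le hg hx hq (N + 1)
  have h2 := norm_taylor_sub_le hg ((norm_real_smul_lt hr0 _ hx).trans hrq) hq (N + 1)
  have h3 := hε x (hx.trans hq)
  have e : (weightedTaylor g hg (fun n => 1 - (r : ℂ) ^ n) N).eval x =
      (∑ n ∈ Finset.range (N + 1), taylorForm g n (fun _ => x) - zeroExt g x) +
      (zeroExt g x - zeroExt g ((r : ℂ) • x)) -
      (∑ n ∈ Finset.range (N + 1), taylorForm g n (fun _ => (r : ℂ) • x) -
        zeroExt g ((r : ℂ) • x)) := by
    rw [weightedTaylor_eval]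
    simp only [taylorForm_smul_diag, sub_mul, one_mul, Finset.sum_sub_distrib]
    ring
  rw [e]
  refine (norm_sub_le _ _).trans ?_
  have h4 := norm_add_le
    (∑ n ∈ Finset.range (N + 1), taylorForm g n (fun _ => x) - zeroExt g x)
    (zeroExt g x - zeroExt g ((r : ℂ) • x))
  linarith

lemma exists_dilation_close {g : UnitBall X →ᵇ ℂ} (hg : UniformContinuous g) {ε : ℝ}
    (hε : 0 < ε) : ∃ r : ℝ, 0 < r ∧ r < 1 ∧
      ∀ x : X, ‖x‖ < 1 → ‖zeroExt g x - zeroExt g ((r : ℂ) • x)‖ ≤ ε := by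
  obtain ⟨δ, hδ, h⟩ := Metric.uniformContinuous_iff.1 hg ε hε
  have hm : 0 < min δ 1 := lt_min hδ one_pos
  have hm1 : min δ 1 ≤ 1 := min_le_right _ _
  obtain ⟨r, hr⟩ : ∃ r : ℝ, r = 1 - min δ 1 / 2 := ⟨_, rfl⟩
  have hr0 : 0 < r := by linarith
  have hr1 : r < 1 := by linarith
  refine ⟨r, hr0, hr1, fun x hx => ?_⟩
  have hrx : ‖(r : ℂ) • x‖ < 1 := (norm_real_smul_lt hr0 _ hx).trans (by linarith)
  have hd : dist x ((r : ℂ) • x) < δ := by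
    have : x - (r : ℂ) • x = ((1 - r : ℝ) : ℂ) • x := by
      rw [Complex.ofReal_sub, sub_smul, Complex.ofReal_one, one_smul]
    rw [dist_eq_norm, this]
    refine (norm_real_smul_lt (by linarith) _ hx).trans_le ?_
    linarith [min_le_left δ 1]
  have := h (a := ⟨x, mem_ball_zero_iff.2 hx⟩) (b := ⟨_, mem_ball_zero_iff.2 hrx⟩) hd
  rw [dist_eq_norm, ← zeroExt_coe, ← zeroExt_coe] at this
  exact this.le

/-- A function in `A_u(B)` is a uniform limit of polynomials, and the Aron-Berner extensions
converge uniformly too. -/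
lemma exists_contPoly_close {g : UnitBall X →ᵇ ℂ} (hg : g ∈ Au X) {ε : ℝ} (hε : 0 < ε) :
    ∃ P : ContPoly X, (∀ x : UnitBall X, ‖P.eval (x : X) - g x‖ ≤ ε) ∧
      ∀ z : Bidual X, ‖z‖ < 1 → ‖P.aronBerner z - aronBernerBall g z‖ ≤ ε := by
  obtain ⟨r, hr0, hr1, hr⟩ := exists_dilation_close hg.2 (half_pos hε)
  have ht : Tendsto (fun N : ℕ => ‖g‖ * r ^ (N + 1) / (1 - r)) atTop (𝓝 0) := by
    have h := (tendsto_pow_atTop_nhds_zero_of_lt_one hr0.le hr1).comp (tendsto_add_atTop_nat 1)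
    simpa using (h.const_mul ‖g‖).div_const (1 - r)
  obtain ⟨N, hN⟩ := (ht.eventually (gt_mem_nhds (half_pos hε))).exists
  refine ⟨weightedTaylor g hg.1 (fun n => (r : ℂ) ^ n) N, fun x => ?_, fun z hz => ?_⟩
  · have hx : ‖(x : X)‖ < 1 := mem_ball_zero_iff.1 x.2
    have h1 := norm_taylor_sub_le hg.1
      ((norm_real_smul_lt hr0 _ hx).trans_eq (mul_one r)) hr1 (N + 1)
    have h2 := hr x hx
    rw [norm_sub_rev] at h2
    simp only [taylorForm_smul_diag] at h1
    rw [weightedTaylor_eval, ← zeroExt_coe]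
    linarith [norm_sub_le_norm_sub_add_norm_sub
      (∑ n ∈ Finset.range (N + 1), (r : ℂ) ^ n * taylorForm g n fun _ => (x : X))
      (zeroExt g ((r : ℂ) • (x : X))) (zeroExt g x)]
  · have h1 := norm_aronBernerHom_sum_sub_le hg.1
      ((norm_real_smul_lt hr0 z hz).trans_eq (mul_one r)) hr1 (N + 1)
    have h2 := norm_aronBernerBall_sub_dilation_le hg.1 hr0 hr1 hr hz
    rw [norm_sub_rev] at h2
    simp only [aronBernerHom_smul_arg] at h1
    rw [weightedTaylor_aronBerner]
    linarith [norm_sub_le_norm_sub_add_norm_sub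
      (∑ n ∈ Finset.range (N + 1), (r : ℂ) ^ n * aronBernerHom n (taylorForm g n) z)
      (aronBernerBall g ((r : ℂ) • z)) (aronBernerBall g z)]

/-! ### Limits along polynomial-star convergent filters -/

lemma tendsto_contPoly_eval (P : ContPoly X) {l : Filter (UnitBall X)} {z₀ : Bidual X}
    (hl : Tendsto UnitBall.toBidual l (@nhds _ (polyStarTopology X) z₀)) :
    Tendsto (fun x : UnitBall X => P.eval (x : X)) l (𝓝 (P.aronBerner z₀)) := by
  have hc : @Continuous _ _ (polyStarTopology X) _ P.aronBerner :=
    continuous_iff_le_induced.2 (iInf_le _ P)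
  refine ((@Continuous.tendsto _ _ (polyStarTopology X) _ _ hc z₀).comp hl).congr fun x => ?_
  exact aronBerner_inclusion P (x : X)

/-- Limits of `g ∈ A_u(B)` along filters converging to `z₀` in the polynomial-star topology
are values of the Aron-Berner extension. -/
lemma aronBernerClosedBall_eq_of_tendsto {g : UnitBall X →ᵇ ℂ} (hg : g ∈ Au X)
    {l : Filter (UnitBall X)} [l.NeBot] {z₀ : Bidual X} (hz₀ : z₀ ∈ closedBall (0 : Bidual X) 1)
    (hl : Tendsto UnitBall.toBidual l (@nhds _ (polyStarTopology X) z₀)) {a : ℂ}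
    (ha : Tendsto g l (𝓝 a)) : aronBernerClosedBall g z₀ = a := by
  have hcl : z₀ ∈ closure (ball (0 : Bidual X) 1) :=
    (closure_ball (0 : Bidual X) one_ne_zero).ge hz₀
  refine extendFrom_eq hcl (Metric.tendsto_nhds.2 fun ε hε => ?_)
  obtain ⟨P, hP, hPz⟩ := exists_contPoly_close hg (show 0 < ε / 4 by positivity)
  have h0 : ‖P.aronBerner z₀ - a‖ ≤ ε / 4 :=
    le_of_tendsto ((tendsto_contPoly_eval P hl).sub ha).norm (Eventually.of_forall hP)
  have hev : ∀ᶠ z in 𝓝[ball (0 : Bidual X) 1] z₀,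
      dist (P.aronBerner z) (P.aronBerner z₀) < ε / 4 :=
    (Metric.tendsto_nhds.1 (continuous_aronBerner P).continuousAt (ε / 4)
      (by positivity)).filter_mono nhdsWithin_le_nhds
  filter_upwards [hev, self_mem_nhdsWithin] with z h1 hz
  have h2 := hPz z ((mem_ball_zero_iff (a := z)).1 hz)
  rw [← dist_eq_norm] at h0 h2
  rw [dist_comm] at h2
  linarith [dist_triangle4 (aronBernerBall g z) (P.aronBerner z) (P.aronBerner z₀) a]

/-- Every bounded function has a limit along an ultrafilter. -/
lemma exists_tendsto_ultrafilter {S : Type*} [TopologicalSpace S] (u : Ultrafilter S)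
    (g : S →ᵇ ℂ) : ∃ a : ℂ, Tendsto g u (𝓝 a) := by
  obtain ⟨a, -, ha⟩ := (isCompact_closedBall (0 : ℂ) ‖g‖).ultrafilter_le_nhds (u.map g)
    (by
      rw [Ultrafilter.coe_map, le_principal_iff, mem_map]
      exact univ_mem' fun x => (mem_closedBall_zero_iff (a := g x)).2 (g.norm_coe_le_norm x))
  exact ⟨a, ha⟩

/-- The character `g ↦ lim g` of bounded functions along an ultrafilter. -/
def ultrafilterLim {S : Type*} [TopologicalSpace S] (u : Ultrafilter S) : (S →ᵇ ℂ) →ₐ[ℂ] ℂ :=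
  have hlim (g : S →ᵇ ℂ) := (exists_tendsto_ultrafilter u g).choose_spec
  AlgHom.ofLinearMap
    { toFun := fun g => (exists_tendsto_ultrafilter u g).choose
      map_add' := fun g h => tendsto_nhds_unique (hlim (g + h)) ((hlim g).add (hlim h))
      map_smul' := fun s g => tendsto_nhds_unique (hlim (s • g)) ((hlim g).const_smul s) }
    (tendsto_nhds_unique (hlim 1) tendsto_const_nhds)
    fun g h => tendsto_nhds_unique (hlim (g * h)) ((hlim g).mul (hlim h))

lemma tendsto_ultrafilterLim {S : Type*} [TopologicalSpace S] (u : Ultrafilter S)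
    (g : S →ᵇ ℂ) : Tendsto g u (𝓝 (ultrafilterLim u g)) :=
  (exists_tendsto_ultrafilter u g).choose_spec

/-- The limit along an ultrafilter converging to `z₀` is a character in the polynomial fiber over
`z₀`, so `f` has limit `c` along each of them. -/
lemma tendsto_of_const_on_polyFiber (H : Subalgebra ℂ (UnitBall X →ᵇ ℂ))
    (hclosed : IsClosed (H : Set (UnitBall X →ᵇ ℂ)))
    {z₀ : Bidual X} (hz₀ : z₀ ∈ closedBall (0 : Bidual X) 1) (f : H) (c : ℂ)
    (hf : ∀ τ ∈ polyFiber H z₀, WeakDual.gelfandTransform ℂ H f τ = c) :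
    Tendsto (f : UnitBall X →ᵇ ℂ)
      (comap UnitBall.toBidual (@nhds _ (polyStarTopology X) z₀)) (𝓝 c) := by
  have : CompleteSpace H := hclosed.completeSpace_coe
  refine (tendsto_iff_ultrafilter _ _ _).2 fun u hu => ?_
  let τ : WeakDual.characterSpace ℂ H :=
    WeakDual.CharacterSpace.equivAlgHom.symm ((ultrafilterLim u).comp H.val)
  have hmem : τ ∈ polyFiber H z₀ := fun g hg =>
    (aronBernerClosedBall_eq_of_tendsto hg hz₀ (tendsto_iff_comap.2 hu)
      (tendsto_ultrafilterLim u _)).symm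
  have hc : ultrafilterLim u (f : UnitBall X →ᵇ ℂ) = c := hf τ hmem
  exact hc ▸ tendsto_ultrafilterLim u _

lemma toBidual_injective : Function.Injective (UnitBall.toBidual (X := X)) := fun _ _ h =>
  Subtype.val_injective ((NormedSpace.inclusionInDoubleDualLi (E := X) ℂ).injective h)

/-- A function on `S` that tends to `c` along points converging to `y` extends continuously
to `y`. -/
lemma extend_eq_and_continuousWithinAt {S Y Z : Type*} [TopologicalSpace Y] [TopologicalSpace Z]
    [T2Space Z] {j : S → Y} (hj : Function.Injective j) {f : S → Z} {y : Y} {c : Z}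
    (h : Tendsto f (comap j (𝓝 y)) (𝓝 c)) :
    Function.extend j f (fun _ => c) y = c ∧
      ContinuousWithinAt (Function.extend j f fun _ => c) (insert y (range j)) y := by
  have hy : Function.extend j f (fun _ => c) y = c := by
    by_cases hyj : ∃ x, j x = y
    · obtain ⟨x, rfl⟩ := hyj
      rw [hj.extend_apply]
      have hx : Tendsto f (pure x) (𝓝 c) :=
        h.mono_left (tendsto_iff_comap.1 (tendsto_pure_nhds j x))
      exact tendsto_nhds_unique (tendsto_pure_nhds f x) hx
    · exact Function.extend_apply' _ _ _ hyj
  refine ⟨hy, ?_⟩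
  rw [continuousWithinAt_insert_self, ContinuousWithinAt, hy, nhdsWithin, ← map_comap,
    tendsto_map'_iff]
  exact h.congr fun x => (hj.extend_apply _ _ x).symm

end PolyCluster
end

theorem corollary2p3 {X : Type*} [NormedAddCommGroup X] [NormedSpace ℂ X] [CompleteSpace X]
    -- `H` is a uniform algebra with `A_u(B) ⊆ H ⊆ H^∞(B)`
    (H : Subalgebra ℂ (PolyCluster.UnitBall X →ᵇ ℂ))
    (hclosed : IsClosed (H : Set (PolyCluster.UnitBall X →ᵇ ℂ)))
    (hAu : PolyCluster.Au X ⊆ (H : Set (PolyCluster.UnitBall X →ᵇ ℂ)))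
    (hHInfty : (H : Set (PolyCluster.UnitBall X →ᵇ ℂ)) ⊆ PolyCluster.HInfty X)
    (z₀ : PolyCluster.Bidual X) (hz₀ : z₀ ∈ closedBall (0 : PolyCluster.Bidual X) 1)
    (f : H) (c : ℂ)
    (hf : ∀ τ ∈ PolyCluster.polyFiber H z₀, WeakDual.gelfandTransform ℂ H f τ = c) :
    -- `f` extends to `B ∪ {z₀}`, with value `c` at `z₀`, polynomial-star continuously at `z₀`
    (∃ F : PolyCluster.Bidual X → ℂ,
      (∀ x : PolyCluster.UnitBall X, F x.toBidual = (f : PolyCluster.UnitBall X →ᵇ ℂ) x) ∧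
      F z₀ = c ∧
      @ContinuousWithinAt _ _ (PolyCluster.polyStarTopology X) _ F
        (insert z₀ (range (PolyCluster.UnitBall.toBidual (X := X)))) z₀) ∧
    -- along every net (indexed by `ι`; more generally every filter) polynomial-star converging
    -- to `z₀`, the values of `f` converge to `c`
    (∀ {ι : Type*} (l : Filter ι) (x : ι → PolyCluster.UnitBall X),
      Tendsto (fun i => (x i).toBidual) l (@nhds _ (PolyCluster.polyStarTopology X) z₀) →
      Tendsto (fun i => (f : PolyCluster.UnitBall X →ᵇ ℂ) (x i)) l (𝓝 c)) := by
  have hlim := PolyCluster.tendsto_of_const_on_polyFiber H hclosed hz₀ f c hf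
  obtain ⟨hc, hcont⟩ := @PolyCluster.extend_eq_and_continuousWithinAt _ _ _
    (PolyCluster.polyStarTopology X) _ _ _ PolyCluster.toBidual_injective _ _ _ hlim
  exact ⟨⟨_, PolyCluster.toBidual_injective.extend_apply _ _, hc, hcont⟩,
    fun l x hx => hlim.comp (tendsto_comap_iff.2 hx)⟩
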